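/- Let $m \ge 7$ be an integer. Call a subset $S \subseteq \mathbb{F}_2^m$ a cap if every subset $T \subseteq S$ with $|T| \le 3$ is linearly independent over $\mathbb{F}_2$, and call a cap maximal if it is not properly contained in any other cap. For $S \subseteq \mathbb{F}_2^m$ let $U_S = \sum_{s \in S} s s^{T} \in \mathbb{F}_2^{m \times m}$, with vectors regarded as columns, and let $\operatorname{rank}(U_S)$ be its rank over $\mathbb{F}_2$. For $v \in \mathbb{F}_2^m$ let $\langle v\rangle$ be the subspace spanned by $v$, and let $\langle v \rangle^{\perp} = \{x \in \mathbb{F}_2^m : \sum_{i=1}^m x_i w_i = 0 \text{ for all } w \in \langle v \rangle\}$. Let $S \subseteq \mathbb{F}_2^m$ be a cap with $$|S| \ge 2^{m-2} + 2^{m-4} - \operatorname{rank}(U_S) + 1.$$ Then there is $v \in \mathbb{F}_2^m$ such that $\mathbb{F}_2^m \setminus \langle v \rangle^{\perp}$ is a maximal cap and $S \subseteq \mathbb{F}_2^m \setminus \langle v \rangle^{\perp}$. Furthermore, $$|S| \le 2^{m-1} - \operatorname{rank}(U_S).$$ -/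

import Mathlib

namespace BinaryCap

/-- A cap in `𝔽₂^m`: every subset of at most three vectors is linearly independent. Since `𝔽₂^m` is
finite, its subsets are represented as finsets. -/
def IsCap {m : ℕ} (S : Finset (Fin m → ZMod 2)) : Prop :=
  ∀ T : Finset (Fin m → ZMod 2), T ⊆ S → T.card ≤ 3 →
    LinearIndepOn (ZMod 2) id (T : Set (Fin m → ZMod 2))

/-- A maximal cap: a cap that is not properly contained in any other cap. -/
def IsMaximalCap {m : ℕ} (S : Finset (Fin m → ZMod 2)) : Prop :=
  IsCap S ∧ ∀ T : Finset (Fin m → ZMod 2), IsCap T → ¬ S ⊂ T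

/-- The Gram matrix `U_S = ∑_{s ∈ S} s sᵀ`, an `m × m` matrix over `𝔽₂`. -/
def gramMatrix {m : ℕ} (S : Finset (Fin m → ZMod 2)) : Matrix (Fin m) (Fin m) (ZMod 2) :=
  ∑ s ∈ S, Matrix.vecMulVec s s

/-- The orthogonal complement `W^⊥` of a subspace `W ⊆ 𝔽₂^m` for the standard inner product
`⟨x, y⟩ = ∑ i, x i * y i`. -/
def perp {m : ℕ} (W : Submodule (ZMod 2) (Fin m → ZMod 2)) : Set (Fin m → ZMod 2) :=
  {x | ∀ w ∈ W, x ⬝ᵥ w = 0}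

end BinaryCap

namespace BinaryCap

/-! Over `𝔽₂`, caps are exactly the sum-free sets. A sum-free set that fills more than a quarter of
the space and has no five-term zero sum has no zero sum of odd length at all, so some linear
functional equals 1 on all of it (`exists_dual_eq_one`). The work lies in excluding five-term zero
sums (`five_sum_ne_zero`).

Given one, extend `S` to a maximal sum-free `B`, which then contains a linear image of the
connection set of the Clebsch graph. Each coset of the span of that image meets `B` in an
independent set of the graph, hence in at most five points, so |B| ≤ 2^(m-2) + 2^(m-4). Five-point
slices are neighbourhoods whose centres give elements of `shifts`, so |B| exceeds 2^(m-2) by at most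
the number of shifts. A shift that is a sum of three elements of `B` makes `B` too small; otherwise
maximality puts every shift in the stabilizer of `B`.

A stabilizer of order at least 8 kills the Gram matrix of `B`, and |S| + rank(U_S) ≤ |B| + rank(U_B)
(`rank_gramMatrix_add_card_le`) then contradicts the size hypothesis; smaller stabilizers make `B`
too small. The same inequality, with a hyperplane complement as `B`, gives the final bound. -/

/-- A sum-free set in an additive structure. -/
def SumFree {G : Type*} [Add G] (B : Finset G) : Prop :=
  ∀ a ∈ B, ∀ b ∈ B, a + b ∉ B

/-! ### Independent sets of the Clebsch graph -/

/-- The vector space `𝔽₂⁴`, as a product. -/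
abbrev V4 : Type := ZMod 2 × ZMod 2 × ZMod 2 × ZMod 2

/-- The connection set of the Clebsch graph on `𝔽₂⁴`. -/
def clebsch : Finset V4 :=
  {(1, 0, 0, 0), (0, 1, 0, 0), (0, 0, 1, 0), (0, 0, 0, 1), (1, 1, 1, 1)}

/-- An independent set of the Clebsch graph. -/
def Indep (J : Finset V4) : Prop :=
  ∀ a ∈ J, ∀ b ∈ J, a + b ∉ clebsch

lemma Indep.mono {J J' : Finset V4} (h : Indep J) (hs : J' ⊆ J) : Indep J' :=
  fun a ha b hb => h a (hs ha) b (hs hb)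

set_option synthInstance.maxHeartbeats 400000 in
set_option synthInstance.maxSize 2000 in
-- The nonzero non-neighbours of 0 are the ten sums of two connection vectors, that is, the edges of
-- K₅. The five vectors sum to zero, so disjoint edges are adjacent in the graph; four pairwise
-- intersecting edges of K₅ form a star.
lemma clebsch_four_pts : ∀ a : V4, a ≠ 0 → a ∉ clebsch → ∀ b : V4, b ≠ 0 → b ∉ clebsch → b ≠ a →
    a + b ∉ clebsch → ∀ c : V4, c ≠ 0 → c ∉ clebsch → c ≠ a → c ≠ b →
    a + c ∉ clebsch → b + c ∉ clebsch → ∀ d : V4, d ≠ 0 → d ∉ clebsch → d ≠ a → d ≠ b → d ≠ c →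
    a + d ∉ clebsch → b + d ∉ clebsch → c + d ∉ clebsch →
    ∃ w ∈ clebsch, a + w ∈ clebsch ∧ b + w ∈ clebsch ∧ c + w ∈ clebsch ∧ d + w ∈ clebsch := by
  decide +kernel

set_option synthInstance.maxHeartbeats 400000 in
set_option synthInstance.maxSize 2000 in
-- Two distinct vertices of the graph have at most two common neighbours, so 0, `a`, `b` determine
-- the centre.
lemma clebsch_unique_center : ∀ w ∈ clebsch, ∀ w' ∈ clebsch, ∀ a : V4, a ≠ 0 → a + w ∈ clebsch →
    a + w' ∈ clebsch → ∀ b : V4, b ≠ 0 → b ≠ a → b + w ∈ clebsch → b + w' ∈ clebsch → w = w' := by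
  decide +kernel

lemma clebsch_translate : ∀ v : V4, (∀ x ∈ clebsch, v + x ∈ clebsch) → v = 0 := by
  decide +kernel

/-- The neighbourhood of `w` in the Clebsch graph. -/
def nbhd (w : V4) : Finset V4 := Finset.univ.filter fun a => a + w ∈ clebsch

lemma card_nbhd : ∀ w : V4, (nbhd w).card = 5 := by decide +kernel

/-- Apart from 0, these neighbourhoods are stars of K₅; two stars share the edge joining their
centres, or coincide. -/
lemma nbhd_overlap_two : ∀ i ∈ clebsch, ∀ j ∈ clebsch,
    ((nbhd i ∩ nbhd j) \ {0}).Nonempty := by decide +kernel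

lemma nbhd_overlap_three : ∀ i ∈ clebsch, ∀ j ∈ clebsch, ∀ k ∈ clebsch,
    2 ≤ (((nbhd i ∩ nbhd j) ∪ (nbhd i ∩ nbhd k) ∪ (nbhd j ∩ nbhd k)) \ {0}).card := by
  decide +kernel

lemma card_pairs : (Finset.univ \ (insert 0 clebsch) : Finset V4).card = 10 := by decide +kernel

lemma Indep.eq_nbhd_of_zero_mem {J : Finset V4} (hJ : Indep J) (h0 : (0 : V4) ∈ J)
    (hc : 5 ≤ J.card) : ∃ w ∈ clebsch, J = nbhd w := by
  have hnc : ∀ y ∈ J, y ∉ clebsch := fun y hy => by simpa using hJ 0 h0 y hy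
  have h4 : 4 ≤ (J.erase 0).card := by rw [Finset.card_erase_of_mem h0]; omega
  obtain ⟨T, hT, hT4⟩ := Finset.exists_subset_card_eq h4
  obtain ⟨a, T, ha, rfl, hT3⟩ := Finset.card_eq_succ.1 hT4
  obtain ⟨b, c, d, hbc, hbd, hcd, rfl⟩ := Finset.card_eq_three.1 hT3
  simp only [Finset.mem_insert, Finset.mem_singleton, not_or] at ha
  obtain ⟨hab, hac, had⟩ := ha
  have mem : ∀ y ∈ ({a, b, c, d} : Finset V4), y ≠ 0 ∧ y ∈ J := fun y hy =>
    Finset.mem_erase.1 (hT hy)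
  obtain ⟨a0, aJ⟩ := mem a (by simp)
  obtain ⟨b0, bJ⟩ := mem b (by simp)
  obtain ⟨c0, cJ⟩ := mem c (by simp)
  obtain ⟨d0, dJ⟩ := mem d (by simp)
  have key : ∀ y ∈ J, y ≠ 0 → y ≠ a → y ≠ b → y ≠ c → ∃ w ∈ clebsch, a + w ∈ clebsch ∧
      b + w ∈ clebsch ∧ c + w ∈ clebsch ∧ y + w ∈ clebsch := fun y hy y0 ya yb yc =>
    clebsch_four_pts a a0 (hnc a aJ) b b0 (hnc b bJ) (Ne.symm hab) (hJ a aJ b bJ)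
      c c0 (hnc c cJ) (Ne.symm hac) (Ne.symm hbc) (hJ a aJ c cJ) (hJ b bJ c cJ)
      y y0 (hnc y hy) ya yb yc (hJ a aJ y hy) (hJ b bJ y hy) (hJ c cJ y hy)
  obtain ⟨w, hw, aw, bw, cw, -⟩ := key d dJ d0 (Ne.symm had) (Ne.symm hbd) (Ne.symm hcd)
  refine ⟨w, hw, Finset.eq_of_subset_of_card_le (fun y hy => ?_) (by rwa [card_nbhd])⟩
  simp only [nbhd, Finset.mem_filter, Finset.mem_univ, true_and]
  by_cases y0 : y = 0
  · simpa [y0] using hw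
  by_cases ya : y = a
  · rwa [ya]
  by_cases yb : y = b
  · rwa [yb]
  by_cases yc : y = c
  · rwa [yc]
  obtain ⟨w', hw', aw', bw', -, yw'⟩ := key y hy y0 ya yb yc
  rwa [clebsch_unique_center w hw w' hw' a a0 aw aw' b b0 (Ne.symm hab) bw bw']

lemma Indep.eq_nbhd {J : Finset V4} (hJ : Indep J) (hc : 5 ≤ J.card) : ∃ w, J = nbhd w := by
  obtain ⟨v, hv⟩ : J.Nonempty := Finset.card_pos.1 (by omega)
  have hmem : ∀ y, y ∈ J.image (· + v) ↔ y + v ∈ J := fun y => by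
    constructor
    · intro hy
      obtain ⟨z, hz, rfl⟩ := Finset.mem_image.1 hy
      rwa [add_assoc, ZModModule.add_self, add_zero]
    · intro hy
      exact Finset.mem_image.2 ⟨_, hy, by rw [add_assoc, ZModModule.add_self, add_zero]⟩
  obtain ⟨w, -, hw⟩ := Indep.eq_nbhd_of_zero_mem (J := J.image (· + v))
    (fun a ha b hb => by
      have := hJ _ ((hmem a).1 ha) _ ((hmem b).1 hb)
      rwa [add_add_add_comm, ZModModule.add_self, add_zero] at this)
    ((hmem 0).2 (by simpa using hv))
    (by rwa [Finset.card_image_of_injective _ (add_left_injective v)])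
  refine ⟨w + v, Finset.ext fun y => ?_⟩
  have h1 : y ∈ J ↔ y + v ∈ J.image (· + v) := by
    rw [hmem, add_assoc, ZModModule.add_self, add_zero]
  rw [h1, hw]
  simp only [nbhd, Finset.mem_filter, Finset.mem_univ, true_and]
  rw [add_assoc, add_comm v w]

lemma Indep.card_le {J : Finset V4} (hJ : Indep J) : J.card ≤ 5 := by
  by_contra h
  obtain ⟨w, rfl⟩ := hJ.eq_nbhd (by omega)
  exact h (card_nbhd w).le

/-- 36 = 4 · 5 + 16: each union has at most five points, and the four intersections `Aᵢ ∩ Bᵢ` are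
disjoint in a space of 16 points. -/
lemma card_add_card_le_thirty_six {A₀ A₁ A₂ A₃ B₀ B₁ B₂ B₃ : Finset V4}
    (h₀ : Indep (A₀ ∪ B₀)) (h₁ : Indep (A₁ ∪ B₁)) (h₂ : Indep (A₂ ∪ B₂)) (h₃ : Indep (A₃ ∪ B₃))
    (h01 : Disjoint A₀ B₁) (h02 : Disjoint A₀ B₂) (h03 : Disjoint A₀ B₃)
    (h12 : Disjoint A₁ B₂) (h13 : Disjoint A₁ B₃) (h23 : Disjoint A₂ B₃) :
    A₀.card + B₀.card + (A₁.card + B₁.card) + (A₂.card + B₂.card) + (A₃.card + B₃.card) ≤ 36 := by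
  have d01 : Disjoint (A₀ ∩ B₀) (A₁ ∩ B₁) :=
    h01.mono Finset.inter_subset_left Finset.inter_subset_right
  have d02 : Disjoint (A₀ ∩ B₀ ∪ A₁ ∩ B₁) (A₂ ∩ B₂) := Finset.disjoint_union_left.2
    ⟨h02.mono Finset.inter_subset_left Finset.inter_subset_right,
      h12.mono Finset.inter_subset_left Finset.inter_subset_right⟩
  have d03 : Disjoint (A₀ ∩ B₀ ∪ A₁ ∩ B₁ ∪ A₂ ∩ B₂) (A₃ ∩ B₃) := Finset.disjoint_union_left.2
    ⟨Finset.disjoint_union_left.2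
      ⟨h03.mono Finset.inter_subset_left Finset.inter_subset_right,
      h13.mono Finset.inter_subset_left Finset.inter_subset_right⟩,
      h23.mono Finset.inter_subset_left Finset.inter_subset_right⟩
  have hU := Finset.card_le_univ (A₀ ∩ B₀ ∪ A₁ ∩ B₁ ∪ A₂ ∩ B₂ ∪ A₃ ∩ B₃)
  rw [Finset.card_union_of_disjoint d03, Finset.card_union_of_disjoint d02,
    Finset.card_union_of_disjoint d01, show Fintype.card V4 = 16 by decide +kernel] at hU
  have e₀ := Finset.card_union_add_card_inter A₀ B₀
  have e₁ := Finset.card_union_add_card_inter A₁ B₁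
  have e₂ := Finset.card_union_add_card_inter A₂ B₂
  have e₃ := Finset.card_union_add_card_inter A₃ B₃
  have := h₀.card_le
  have := h₁.card_le
  have := h₂.card_le
  have := h₃.card_le
  omega

/-- The zero vector lies in each `Aᵢ`, and `Aᵢ` and `Bⱼ` are disjoint for `i ≠ j`. -/
lemma card_add_card_le_twenty_three {A₁ A₂ A₃ B₁ B₂ B₃ : Finset V4}
    (h₁ : Indep (A₁ ∪ B₁)) (h₂ : Indep (A₂ ∪ B₂)) (h₃ : Indep (A₃ ∪ B₃))
    (z₁ : (0 : V4) ∈ A₁) (z₂ : (0 : V4) ∈ A₂) (z₃ : (0 : V4) ∈ A₃)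
    (h12 : Disjoint A₁ B₂) (h13 : Disjoint A₁ B₃) (h23 : Disjoint A₂ B₃)
    (h21 : Disjoint A₂ B₁) (h31 : Disjoint A₃ B₁) (h32 : Disjoint A₃ B₂) :
    (A₁.card + B₁.card) + (A₂.card + B₂.card) + (A₃.card + B₃.card) ≤ 23 := by
  have e₁ := Finset.card_union_add_card_inter A₁ B₁
  have e₂ := Finset.card_union_add_card_inter A₂ B₂
  have e₃ := Finset.card_union_add_card_inter A₃ B₃
  have l₁ := h₁.card_le
  have l₂ := h₂.card_le
  have l₃ := h₃.card_le
  set J₁ := A₁ ∪ B₁ with hJ₁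
  set J₂ := A₂ ∪ B₂ with hJ₂
  set J₃ := A₃ ∪ B₃ with hJ₃
  have m₁ : (0 : V4) ∈ J₁ := Finset.mem_union_left _ z₁
  have m₂ : (0 : V4) ∈ J₂ := Finset.mem_union_left _ z₂
  have m₃ : (0 : V4) ∈ J₃ := Finset.mem_union_left _ z₃
  have d12 : Disjoint (A₁ ∩ B₁) (A₂ ∩ B₂) :=
    h12.mono Finset.inter_subset_left Finset.inter_subset_right
  have d13 : Disjoint (A₁ ∩ B₁ ∪ A₂ ∩ B₂) (A₃ ∩ B₃) := Finset.disjoint_union_left.2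
    ⟨h13.mono Finset.inter_subset_left Finset.inter_subset_right,
      h23.mono Finset.inter_subset_left Finset.inter_subset_right⟩
  have hcard : (A₁ ∩ B₁ ∪ A₂ ∩ B₂ ∪ A₃ ∩ B₃).card
      = (A₁ ∩ B₁).card + (A₂ ∩ B₂).card + (A₃ ∩ B₃).card := by
    rw [Finset.card_union_of_disjoint d13, Finset.card_union_of_disjoint d12]
  -- A point of `Aᵢ ∩ Bᵢ` is nonzero and lies in no other `Jⱼ`, so these intersections fit into the
  -- ten edges of K₅ outside `D`. The total is at most |J₁| + |J₂| + |J₃| + 10 - |D|, and five-point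
  -- `Jᵢ` force overlaps: 15 - 2, 14 - 1 and 13 all give 23.
  set D := ((J₁ ∩ J₂) ∪ (J₁ ∩ J₃) ∪ (J₂ ∩ J₃)) \ {0} with hD
  have hpairs : ∀ J : Finset V4, Indep J → (0 : V4) ∈ J → ∀ y ∈ J, y ≠ 0 →
      y ∈ (Finset.univ \ (insert 0 clebsch) : Finset V4) := fun J hJ h0 y hy hy0 => by
    have := hJ 0 h0 y hy
    rw [zero_add] at this
    simp [hy0, this]
  have hDP : D ⊆ Finset.univ \ insert 0 clebsch := fun y hy => by
    simp only [hD, Finset.mem_sdiff, Finset.mem_union, Finset.mem_inter,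
      Finset.mem_singleton] at hy
    rcases hy with ⟨(⟨hy, -⟩ | ⟨hy, -⟩) | ⟨hy, -⟩, hy0⟩
    · exact hpairs _ h₁ m₁ y hy hy0
    · exact hpairs _ h₁ m₁ y hy hy0
    · exact hpairs _ h₂ m₂ y hy hy0
  rw [Finset.disjoint_left] at h12 h13 h23 h21 h31 h32
  have hCP : A₁ ∩ B₁ ∪ A₂ ∩ B₂ ∪ A₃ ∩ B₃ ⊆ (Finset.univ \ insert 0 clebsch) \ D := fun y hy => by
    have hy' : (y ∈ A₁ ∧ y ∈ B₁ ∨ y ∈ A₂ ∧ y ∈ B₂) ∨ y ∈ A₃ ∧ y ∈ B₃ := by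
      simpa only [Finset.mem_union, Finset.mem_inter] using hy
    have hy0 : y ≠ 0 := by
      rintro rfl
      grind
    refine Finset.mem_sdiff.2 ⟨?_, ?_⟩
    · rcases hy' with (⟨hy, -⟩ | ⟨hy, -⟩) | ⟨hy, -⟩
      · exact hpairs _ h₁ m₁ y (Finset.mem_union_left _ hy) hy0
      · exact hpairs _ h₂ m₂ y (Finset.mem_union_left _ hy) hy0
      · exact hpairs _ h₃ m₃ y (Finset.mem_union_left _ hy) hy0
    · simp only [hD, hJ₁, hJ₂, hJ₃, Finset.mem_sdiff, Finset.mem_union, Finset.mem_inter,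
        Finset.mem_singleton]
      grind
  have hbound := Finset.card_le_card hCP
  rw [Finset.card_sdiff_of_subset hDP, card_pairs, hcard] at hbound
  have hDle := Finset.card_le_card hDP
  rw [card_pairs] at hDle
  have pair : ∀ {J J' : Finset V4}, Indep J → Indep J' → (0 : V4) ∈ J → (0 : V4) ∈ J' →
      5 ≤ J.card → 5 ≤ J'.card → (J ∩ J') \ {0} ⊆ D → 1 ≤ D.card := by
    intro J J' hJ hJ' h0 h0' hc hc' hsub
    obtain ⟨i, hi, rfl⟩ := hJ.eq_nbhd_of_zero_mem h0 hc
    obtain ⟨j, hj, rfl⟩ := hJ'.eq_nbhd_of_zero_mem h0' hc'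
    exact Finset.card_pos.2 ((nbhd_overlap_two i hi j hj).mono hsub)
  have p12 : 5 ≤ J₁.card → 5 ≤ J₂.card → 1 ≤ D.card := fun a b =>
    pair h₁ h₂ m₁ m₂ a b (Finset.sdiff_subset_sdiff (by grind) le_rfl)
  have p13 : 5 ≤ J₁.card → 5 ≤ J₃.card → 1 ≤ D.card := fun a b =>
    pair h₁ h₃ m₁ m₃ a b (Finset.sdiff_subset_sdiff (by grind) le_rfl)
  have p23 : 5 ≤ J₂.card → 5 ≤ J₃.card → 1 ≤ D.card := fun a b =>
    pair h₂ h₃ m₂ m₃ a b (Finset.sdiff_subset_sdiff (by grind) le_rfl)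
  have p123 : 5 ≤ J₁.card → 5 ≤ J₂.card → 5 ≤ J₃.card → 2 ≤ D.card := fun a b c => by
    obtain ⟨i, hi, ei⟩ := h₁.eq_nbhd_of_zero_mem m₁ a
    obtain ⟨j, hj, ej⟩ := h₂.eq_nbhd_of_zero_mem m₂ b
    obtain ⟨k, hk, ek⟩ := h₃.eq_nbhd_of_zero_mem m₃ c
    rw [hD, ei, ej, ek]
    exact nbhd_overlap_three i hi j hj k hk
  omega

/-! ### Slicing a sum-free set along cosets of a Clebsch copy -/

section Slices

set_option linter.unusedSectionVars false

variable {G : Type*} [AddCommGroup G] [Module (ZMod 2) G] [Fintype G] [DecidableEq G]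

/-- The part of `B` in the translate of the range of `ψ` by `h`, read in `𝔽₂⁴`. -/
def slice (B : Finset G) (ψ : V4 →ₗ[ZMod 2] G) (h : G) : Finset V4 :=
  Finset.univ.filter fun v => h + ψ v ∈ B

/-- The translations that carry the image of the connection set into `B`. -/
def shifts (B : Finset G) (ψ : V4 →ₗ[ZMod 2] G) : Finset G :=
  Finset.univ.filter fun c => ∀ x ∈ clebsch, c + ψ x ∈ B

variable {B : Finset G} {ψ : V4 →ₗ[ZMod 2] G}

lemma mem_slice {h : G} {v : V4} : v ∈ slice B ψ h ↔ h + ψ v ∈ B := by simp [slice]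

lemma mem_shifts {c : G} : c ∈ shifts B ψ ↔ ∀ x ∈ clebsch, c + ψ x ∈ B := by simp [shifts]

lemma sum_card_slice (B : Finset G) (ψ : V4 →ₗ[ZMod 2] G) (t : G) :
    ∑ g, (slice B ψ (g + t)).card = 16 * B.card := by
  have h1 : ∀ v : V4, ∑ g : G, (if g + t + ψ v ∈ B then 1 else 0) = B.card := fun v => by
    have := Equiv.sum_comp (Equiv.addRight (t + ψ v)) (fun g : G => if g ∈ B then 1 else 0)
    simp only [Equiv.coe_addRight, ← add_assoc] at this
    rw [this]
    simp
  simp only [slice, Finset.card_filter]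
  rw [Finset.sum_comm]
  simp only [h1, Finset.sum_const, smul_eq_mul]
  rw [show (Finset.univ : Finset V4).card = 16 by decide +kernel]

/-- If two points were joined by `x` in the graph, their images would sum to `ψ x` (same slice) or
`c + ψ x` (different slices), both in `B`. -/
lemma indep_slice_union (hB : SumFree B) (hX : ∀ x ∈ clebsch, ψ x ∈ B) {c : G}
    (hc : c ∈ shifts B ψ) (h : G) : Indep (slice B ψ h ∪ slice B ψ (h + c)) := by
  have same : ∀ k : G, ∀ a b : V4, k + ψ a ∈ B → k + ψ b ∈ B → a + b ∉ clebsch :=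
    fun k a b ha hb hab => hB _ ha _ hb (by
      rw [add_add_add_comm, ZModModule.add_self, zero_add, ← map_add]
      exact hX _ hab)
  have cross : ∀ a b : V4, h + ψ a ∈ B → h + c + ψ b ∈ B → a + b ∉ clebsch :=
    fun a b ha hb hab => hB _ ha _ hb (by
      rw [add_assoc h c, add_add_add_comm, ZModModule.add_self, zero_add, add_left_comm, ← map_add]
      exact mem_shifts.1 hc _ hab)
  intro a ha b hb
  rw [Finset.mem_union, mem_slice, mem_slice] at ha hb
  rcases ha with ha | ha <;> rcases hb with hb | hb
  · exact same h a b ha hb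
  · exact cross a b ha hb
  · rw [add_comm]
    exact cross b a hb ha
  · exact same _ a b ha hb

lemma card_slice_le (hB : SumFree B) (hX : ∀ x ∈ clebsch, ψ x ∈ B) (h : G) :
    (slice B ψ h).card ≤ 5 :=
  ((indep_slice_union hB hX (c := 0) (mem_shifts.2 (by simpa using hX)) h).mono
    Finset.subset_union_left).card_le

lemma disjoint_slice (hB : SumFree B) {p q : G} (h : p + q ∈ B) :
    Disjoint (slice B ψ p) (slice B ψ q) :=
  Finset.disjoint_left.2 fun v hp hq => hB _ (mem_slice.1 hp) _ (mem_slice.1 hq) (by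
    rwa [add_add_add_comm, ZModModule.add_self, add_zero])

lemma sixteen_card_le (hB : SumFree B) (hX : ∀ x ∈ clebsch, ψ x ∈ B) :
    16 * B.card ≤ 5 * Fintype.card G := by
  rw [← sum_card_slice B ψ 0]
  refine (Finset.sum_le_card_nsmul _ _ 5 fun g _ => card_slice_le hB hX _).trans ?_
  rw [Finset.card_univ, smul_eq_mul, mul_comm]

/-- A five-point slice at `g` is some `nbhd w`, which makes `g + ψ w` a shift; each shift arises
from at most 16 values of `g`. -/
lemma sixteen_card_le_shifts (hB : SumFree B) (hX : ∀ x ∈ clebsch, ψ x ∈ B) :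
    16 * B.card ≤ 4 * Fintype.card G + 16 * (shifts B ψ).card := by
  have h0 : (0 : G) ∈ shifts B ψ := mem_shifts.2 (by simpa using hX)
  have hsub : (Finset.univ.filter fun g => 5 ≤ (slice B ψ (g + 0)).card) ⊆
      (shifts B ψ ×ˢ (Finset.univ : Finset V4)).image fun p => p.1 + ψ p.2 := fun g hg => by
    have hg' : 5 ≤ (slice B ψ g).card := by simpa using hg
    obtain ⟨w, hw⟩ := ((indep_slice_union hB hX h0 g).mono
      Finset.subset_union_left).eq_nbhd hg'
    refine Finset.mem_image.2 ⟨(g + ψ w, w), ?_, ?_⟩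
    · refine Finset.mem_product.2 ⟨mem_shifts.2 fun x hx => ?_, Finset.mem_univ _⟩
      rw [add_assoc, ← map_add, ← mem_slice, hw]
      simpa [nbhd, add_right_comm w x w, ZModModule.add_self] using hx
    · rw [add_assoc, ZModModule.add_self, add_zero]
  have hcard : (Finset.univ.filter fun g => 5 ≤ (slice B ψ (g + 0)).card).card ≤
      16 * (shifts B ψ).card := by
    refine (Finset.card_le_card hsub).trans (Finset.card_image_le.trans ?_)
    rw [Finset.card_product, show (Finset.univ : Finset V4).card = 16 by decide +kernel, mul_comm]
  rw [← sum_card_slice B ψ 0]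
  have : ∀ g : G, (slice B ψ (g + 0)).card ≤ 4 + if 5 ≤ (slice B ψ (g + 0)).card then 1 else 0 :=
    fun g => by
      have := card_slice_le hB hX (g + 0)
      split_ifs <;> omega
  refine (Finset.sum_le_sum fun g _ => this g).trans ?_
  rw [Finset.sum_add_distrib, ← Finset.card_filter, Finset.sum_const, Finset.card_univ,
    smul_eq_mul]
  omega

section Triple

variable {s₁ s₂ s₃ : G}

lemma disjoint_slices_of_triple {s₁ s₃ : G} (hB : SumFree B) (h₁ : s₁ ∈ B) (s₂ : G)
    (h₃ : s₃ ∈ B) (g : G) :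
    Disjoint (slice B ψ (g + (s₁ + s₂ + s₃))) (slice B ψ (g + s₁ + (s₁ + s₂ + s₃))) ∧
    Disjoint (slice B ψ g) (slice B ψ (g + s₁)) ∧
    Disjoint (slice B ψ (g + s₁)) (slice B ψ (g + s₂ + (s₁ + s₂ + s₃))) := by
  have e := ZModModule.add_self (G := G)
  refine ⟨disjoint_slice hB ?_, disjoint_slice hB ?_, disjoint_slice hB ?_⟩
  · convert h₁ using 1
    linear_combination (norm := abel) e g + e s₁ + e s₂ + e s₃
  · convert h₁ using 1
    linear_combination (norm := abel) e g
  · convert h₃ using 1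
    linear_combination (norm := abel) e g + e s₁ + e s₂

lemma card_slices_le_of_triple (hB : SumFree B) (hX : ∀ x ∈ clebsch, ψ x ∈ B) (h₁ : s₁ ∈ B)
    (h₂ : s₂ ∈ B) (h₃ : s₃ ∈ B) {c : G} (hc : c ∈ shifts B ψ) (hs : c = s₁ + s₂ + s₃) (g : G) :
    (slice B ψ (g + c)).card + (slice B ψ g).card +
    ((slice B ψ (g + s₁)).card + (slice B ψ (g + s₁ + c)).card) +
    ((slice B ψ (g + s₂)).card + (slice B ψ (g + s₂ + c)).card) +
    ((slice B ψ (g + s₃)).card + (slice B ψ (g + s₃ + c)).card) ≤ 36 := by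
  have I := indep_slice_union hB hX hc
  have d123 := disjoint_slices_of_triple (ψ := ψ) hB h₁ s₂ h₃ g
  have d231 := disjoint_slices_of_triple (ψ := ψ) hB h₂ s₃ h₁ g
  have d312 := disjoint_slices_of_triple (ψ := ψ) hB h₃ s₁ h₂ g
  have d132 := disjoint_slices_of_triple (ψ := ψ) hB h₁ s₃ h₂ g
  rw [show s₂ + s₃ + s₁ = s₁ + s₂ + s₃ by abel, ← hs] at d231
  rw [show s₃ + s₁ + s₂ = s₁ + s₂ + s₃ by abel, ← hs] at d312
  rw [show s₁ + s₃ + s₂ = s₁ + s₂ + s₃ by abel, ← hs] at d132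
  rw [← hs] at d123
  exact card_add_card_le_thirty_six (by rw [Finset.union_comm]; exact I g) (I _) (I _) (I _)
    d123.1 d231.1 d312.1 d123.2.2 d132.2.2 d231.2.2

/-- Sum the eight-slice bound over all `g`: each of the eight terms contributes 16 |B|. -/
lemma card_le_of_triple (hB : SumFree B) (hX : ∀ x ∈ clebsch, ψ x ∈ B) (h₁ : s₁ ∈ B)
    (h₂ : s₂ ∈ B) (h₃ : s₃ ∈ B) (hc : s₁ + s₂ + s₃ ∈ shifts B ψ) :
    128 * B.card ≤ 36 * Fintype.card G := by
  have key := Finset.sum_le_card_nsmul (Finset.univ : Finset G) _ 36 fun g _ =>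
    card_slices_le_of_triple hB hX h₁ h₂ h₃ hc rfl g
  simp only [Finset.sum_add_distrib, Finset.card_univ, smul_eq_mul, add_assoc _ _ (s₁ + s₂ + s₃),
    sum_card_slice] at key
  have h0 := sum_card_slice B ψ 0
  simp only [add_zero] at h0
  simp only [add_assoc, h0] at key
  simp only [← add_assoc] at key
  omega

lemma clebsch_sum_three : ∀ v : V4, v ≠ 0 → v ∈ clebsch ∨
    ∃ a ∈ clebsch, ∃ b ∈ clebsch, ∃ c ∈ clebsch, v = a + b + c := by
  decide +kernel

lemma injective_of_sumFree (hB : SumFree B) (hX : ∀ x ∈ clebsch, ψ x ∈ B) :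
    ∀ v, ψ v = 0 → v = 0 := by
  intro v hv
  by_contra h0
  have hz : (0 : G) ∉ B := fun h => hB 0 h 0 h (by simpa using h)
  rcases clebsch_sum_three v h0 with h | ⟨a, ha, b, hb, c, hc, rfl⟩
  · exact hz (hv ▸ hX v h)
  · refine hB _ (hX a ha) _ (hX b hb) ?_
    rw [map_add, map_add, ← ZModModule.sub_eq_add, sub_eq_zero] at hv
    rw [hv]
    exact hX c hc

lemma slice_eq_clebsch (hB : SumFree B) (hX : ∀ x ∈ clebsch, ψ x ∈ B) {c : G}
    (hc : c ∈ shifts B ψ) : slice B ψ c = clebsch :=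
  (Finset.eq_of_subset_of_card_le (fun x hx => mem_slice.2 (mem_shifts.1 hc x hx))
    ((card_slice_le hB hX c).trans (by decide))).symm

/-- Needed for m = 7. The cosets of 0, `c`, `sᵢ`, `sᵢ + c` fill `G`; the first two slices have five
points each and the other six at most 23 together. -/
lemma card_le_thirty_three_of_triple (hB : SumFree B) (hX : ∀ x ∈ clebsch, ψ x ∈ B) (h₁ : s₁ ∈ B)
    (h₂ : s₂ ∈ B) (h₃ : s₃ ∈ B) {c : G} (hc : c ∈ shifts B ψ) (hs : c = s₁ + s₂ + s₃)
    (hG : Fintype.card G = 128) : B.card ≤ 33 := by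
  have e := ZModModule.add_self (G := G)
  have h0 : (0 : G) ∈ shifts B ψ := mem_shifts.2 (by simpa using hX)
  have sl0 := slice_eq_clebsch hB hX h0
  have slc := slice_eq_clebsch hB hX hc
  -- Translation by `c` swaps the parts of `B` in the cosets of 0 and `c`, whereas `a + c = b + d`
  -- is not in `B`.
  have hsc : ∀ {a b d : G}, a ∈ B → b ∈ B → d ∈ B → c = a + b + d → ∀ v, a ≠ ψ v ∧ a ≠ c + ψ v := by
    intro a b d ha hb hd habd v
    have hac : a + c ∉ B := by
      rw [habd, show a + (a + b + d) = b + d by linear_combination (norm := abel) e a]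
      exact hB b hb d hd
    refine ⟨fun h => hac ?_, fun h => hac ?_⟩
    · have : v ∈ slice B ψ 0 := mem_slice.2 (by rwa [zero_add, ← h])
      rw [sl0] at this
      rw [h, add_comm]
      exact mem_shifts.1 hc v this
    · have : v ∈ slice B ψ c := mem_slice.2 (by rwa [← h])
      rw [slc] at this
      rw [h, show c + ψ v + c = ψ v by linear_combination (norm := abel) e c]
      exact hX v this
  have n₁ := hsc h₁ h₂ h₃ hs
  have n₂ := hsc h₂ h₁ h₃ (by rw [hs]; abel)
  have n₃ := hsc h₃ h₁ h₂ (by rw [hs]; abel)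
  have hc0 : c ≠ 0 := by
    rintro rfl
    refine hB _ h₁ _ h₂ ?_
    rw [← ZModModule.sub_eq_add, eq_comm, sub_eq_zero] at hs
    rwa [hs]
  have hcψ : ∀ v, c ≠ ψ v := fun v hv => hc0 (by
    rw [hv, clebsch_translate v fun x hx => ?_, map_zero]
    rw [← sl0, mem_slice, zero_add, map_add, ← hv]
    exact mem_shifts.1 hc x hx)
  let Φ : V4 × (ZMod 2 × ZMod 2 × ZMod 2) →ₗ[ZMod 2] G :=
    ψ.coprod ((LinearMap.toSpanSingleton (ZMod 2) G c).coprod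
      ((LinearMap.toSpanSingleton (ZMod 2) G s₁).coprod (LinearMap.toSpanSingleton (ZMod 2) G s₂)))
  have hΦ : ∀ v a b d, Φ (v, a, b, d) = ψ v + (a • c + (b • s₁ + d • s₂)) := fun v a b d => by
    simp [Φ]
  have z2 : ∀ a : ZMod 2, a = 0 ∨ a = 1 := by decide
  have neg : ∀ x y : G, x + y = 0 → y = x := fun x y h => by
    rw [← ZModModule.sub_eq_add, sub_eq_zero] at h
    exact h.symm
  have hinj : Function.Injective Φ := by
    refine (injective_iff_map_eq_zero Φ).2 ?_
    rintro ⟨v, a, b, d⟩ h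
    rw [hΦ] at h
    have hcon : a = 0 ∧ b = 0 ∧ d = 0 := by
      rcases z2 a with rfl | rfl <;> rcases z2 b with rfl | rfl <;> rcases z2 d with rfl | rfl <;>
        simp only [zero_smul, one_smul, zero_add, add_zero] at h
      · simp
      · exact absurd (neg _ _ h) (n₂ v).1
      · exact absurd (neg _ _ h) (n₁ v).1
      · refine absurd ?_ (n₃ v).2
        linear_combination (norm := abel) -h - hs
      · exact absurd (neg _ _ h) (hcψ v)
      · refine absurd ?_ (n₂ v).2
        linear_combination (norm := abel) h - e c - e (ψ v)
      · refine absurd ?_ (n₁ v).2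
        linear_combination (norm := abel) h - e c - e (ψ v)
      · refine absurd ?_ (n₃ v).1
        linear_combination (norm := abel) -h - hs + e c
    obtain ⟨rfl, rfl, rfl⟩ := hcon
    simp only [zero_smul, add_zero] at h
    rw [injective_of_sumFree hB hX v h]
    rfl
  have hsurj : Function.Surjective Φ :=
    ((Fintype.bijective_iff_injective_and_card Φ).2 ⟨hinj, by
      rw [hG]; simp [Fintype.card_prod, ZMod.card]⟩).2
  have hsub : B ⊆ Finset.univ.biUnion fun t : ZMod 2 × ZMod 2 × ZMod 2 =>
      (slice B ψ (t.1 • c + (t.2.1 • s₁ + t.2.2 • s₂))).image fun v =>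
        (t.1 • c + (t.2.1 • s₁ + t.2.2 • s₂)) + ψ v := fun g hg => by
    obtain ⟨⟨v, a, b, d⟩, rfl⟩ := hsurj g
    rw [hΦ, add_comm] at hg ⊢
    exact Finset.mem_biUnion.2 ⟨(a, b, d), Finset.mem_univ _,
      Finset.mem_image.2 ⟨v, mem_slice.2 hg, rfl⟩⟩
  have hle := (Finset.card_le_card hsub).trans (Finset.card_biUnion_le.trans
    (Finset.sum_le_sum fun t _ => Finset.card_image_le))
  have two : ∀ f : ZMod 2 → ℕ, ∑ i, f i = f 0 + f 1 := fun f => Fin.sum_univ_two f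
  simp only [Fintype.sum_prod_type, two, zero_smul, one_smul, zero_add, add_zero, sl0, slc] at hle
  have I := indep_slice_union hB hX hc
  have d123 := disjoint_slices_of_triple (ψ := ψ) hB h₁ s₂ h₃ 0
  have d231 := disjoint_slices_of_triple (ψ := ψ) hB h₂ s₃ h₁ 0
  have d312 := disjoint_slices_of_triple (ψ := ψ) hB h₃ s₁ h₂ 0
  have d132 := disjoint_slices_of_triple (ψ := ψ) hB h₁ s₃ h₂ 0
  have d213 := disjoint_slices_of_triple (ψ := ψ) hB h₂ s₁ h₃ 0
  have d321 := disjoint_slices_of_triple (ψ := ψ) hB h₃ s₂ h₁ 0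
  rw [show s₂ + s₃ + s₁ = s₁ + s₂ + s₃ by abel, ← hs] at d231
  rw [show s₃ + s₁ + s₂ = s₁ + s₂ + s₃ by abel, ← hs] at d312
  rw [show s₁ + s₃ + s₂ = s₁ + s₂ + s₃ by abel, ← hs] at d132
  rw [show s₂ + s₁ + s₃ = s₁ + s₂ + s₃ by abel, ← hs] at d213
  rw [show s₃ + s₂ + s₁ = s₁ + s₂ + s₃ by abel, ← hs] at d321
  rw [← hs] at d123
  simp only [zero_add] at d123 d231 d312 d132 d213 d321
  have z : ∀ s ∈ B, (0 : V4) ∈ slice B ψ s := fun s hs' => mem_slice.2 (by simpa using hs')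
  have h23 := card_add_card_le_twenty_three (I s₁) (I s₂) (I s₃) (z _ h₁) (z _ h₂) (z _ h₃)
    d123.2.2 d132.2.2 d231.2.2 d213.2.2 d312.2.2 d321.2.2
  rw [show s₁ + s₂ = s₃ + c by linear_combination (norm := abel) -hs - e s₃,
    show c + s₁ = s₁ + c by abel, show c + s₂ = s₂ + c by abel,
    show c + (s₃ + c) = s₃ by linear_combination (norm := abel) e c] at hle
  have h5 : clebsch.card = 5 := by decide
  omega

end Triple

end Slices

/-! ### From no five-term zero sum to a linear functional -/

section Bipartite

variable {G : Type*} [AddCommGroup G] [Module (ZMod 2) G]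

omit [Module (ZMod 2) G] in
lemma SumFree.zero_notMem {S : Finset G} (hS : SumFree S) : (0 : G) ∉ S :=
  fun h => hS 0 h 0 h (by simpa using h)

lemma eq_of_add_eq_zero {a b : G} (h : a + b = 0) : a = b := by
  rwa [← ZModModule.sub_eq_add, sub_eq_zero] at h

lemma SumFree.add_add_ne_zero {S : Finset G} (hS : SumFree S) {a b c : G} (ha : a ∈ S)
    (hb : b ∈ S) (hc : c ∈ S) : a + b + c ≠ 0 := fun h => by
  have := hS a ha b hb
  rw [eq_of_add_eq_zero h] at this
  exact this hc

/-- The translates of `S` by 0, `a`, `u`, `a + u` are pairwise disjoint. -/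
lemma four_mul_card_le [Fintype G] {S : Finset G} {a u : G}
    (h₁ : ∀ s ∈ S, ∀ t ∈ S, s + t ≠ a) (h₂ : ∀ s ∈ S, ∀ t ∈ S, s + t ≠ u)
    (h₃ : ∀ s ∈ S, ∀ t ∈ S, s + t ≠ a + u) : 4 * S.card ≤ Fintype.card G := by
  classical
  have e := ZModModule.add_self (G := G)
  have dis : ∀ p q : G, (∀ s ∈ S, ∀ t ∈ S, s + t ≠ p + q) →
      Disjoint (S.image (· + p)) (S.image (· + q)) := fun p q h =>
    Finset.disjoint_left.2 fun x hp hq => by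
      obtain ⟨s, hs, rfl⟩ := Finset.mem_image.1 hp
      obtain ⟨t, ht, hst⟩ := Finset.mem_image.1 hq
      refine h s hs t ht ?_
      linear_combination (norm := abel) hst + e s - e q
  have card : ∀ p : G, (S.image (· + p)).card = S.card := fun p =>
    Finset.card_image_of_injective _ (add_left_injective p)
  have hle := Finset.card_le_univ
    (S.image (· + 0) ∪ S.image (· + a) ∪ (S.image (· + u) ∪ S.image (· + (a + u))))
  rw [Finset.card_union_of_disjoint, Finset.card_union_of_disjoint (dis _ _ (by simpa using h₁)),
    Finset.card_union_of_disjoint (dis _ _ ?_), card, card, card, card] at hle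
  · omega
  · rw [show u + (a + u) = a by linear_combination (norm := abel) e u]
    exact h₁
  · simp only [Finset.disjoint_union_left, Finset.disjoint_union_right]
    refine ⟨⟨dis _ _ (by simpa using h₂), dis _ _ h₃⟩, dis _ _ (by simpa using h₃), dis _ _ ?_⟩
    rw [show a + (a + u) = u by linear_combination (norm := abel) e a]
    exact h₂

lemma odd_list_sum_ne_zero [Fintype G] {S : Finset G} (hS : SumFree S)
    (hcard : Fintype.card G < 4 * S.card)
    (h5 : ∀ a ∈ S, ∀ b ∈ S, ∀ c ∈ S, ∀ d ∈ S, ∀ e ∈ S, a + b + c + d + e ≠ 0) (n : ℕ) :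
    ∀ l : List G, l.length = 2 * n + 1 → (∀ x ∈ l, x ∈ S) → l.sum ≠ 0 := by
  induction n using Nat.strong_induction_on with
  | _ n ih =>
    intro l hl hmem h0
    match n, l, hl, hmem, h0 with
    | 0, [a], _, hmem, h0 =>
      rw [List.sum_singleton] at h0
      exact hS.zero_notMem (h0 ▸ hmem a (List.mem_singleton_self a))
    | 1, [a, b, c], _, hmem, h0 =>
      simp only [List.mem_cons, List.not_mem_nil, or_false, forall_eq_or_imp, forall_eq] at hmem
      exact hS.add_add_ne_zero hmem.1 hmem.2.1 hmem.2.2 (by simpa [add_assoc] using h0)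
    | 2, [a, b, c, d, e], _, hmem, h0 =>
      simp only [List.mem_cons, List.not_mem_nil, or_false, forall_eq_or_imp, forall_eq] at hmem
      exact h5 a hmem.1 b hmem.2.1 c hmem.2.2.1 d hmem.2.2.2.1 e hmem.2.2.2.2
        (by simpa [add_assoc] using h0)
    | k + 3, a :: b :: c :: d :: l', hl, hmem, h0 =>
      simp only [List.mem_cons, forall_eq_or_imp] at hmem
      obtain ⟨ha, hb, hc, hd, hl'⟩ := hmem
      simp only [List.length_cons] at hl
      simp only [List.sum_cons] at h0
      -- With `u = b + c + d`: `s + t = a` breaks sum-freeness, `s + t = u` is a five-term zero sum,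
      -- and `s + t = a + u` shortens the relation by two.
      refine absurd (four_mul_card_le (S := S) (a := a) (u := b + c + d) ?_ ?_ ?_) (by omega)
      · exact fun s hs t ht h => hS s hs t ht (h ▸ ha)
      · intro s hs t ht h
        refine ih 2 (by omega) [s, t, b, c, d] rfl (by simp [hs, ht, hb, hc, hd]) ?_
        simp only [List.sum_cons, List.sum_nil]
        linear_combination (norm := abel) h + ZModModule.add_self (b + c + d)
      · intro s hs t ht h
        refine ih (k + 2) (by omega) (s :: t :: l') (by simp only [List.length_cons]; omega)
          (by simpa [hs, ht] using hl') ?_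
        simp only [List.sum_cons]
        linear_combination (norm := abel) h + h0

lemma exists_dual_eq_one [Fintype G] {S : Finset G} (hS : SumFree S)
    (hcard : Fintype.card G < 4 * S.card)
    (h5 : ∀ a ∈ S, ∀ b ∈ S, ∀ c ∈ S, ∀ d ∈ S, ∀ e ∈ S, a + b + c + d + e ≠ 0) :
    ∃ f : G →ₗ[ZMod 2] ZMod 2, ∀ s ∈ S, f s = 1 := by
  obtain ⟨s₀, hs₀⟩ : S.Nonempty := Finset.card_pos.1 (by omega)
  have z2 : ∀ a : ZMod 2, a = 0 ∨ a = 1 := by decide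
  -- The span consists of sums of even length, so it cannot contain `s₀` without an odd zero sum.
  have even : ∀ y ∈ Submodule.span (ZMod 2) {y | ∃ s ∈ S, y = s₀ + s},
      ∃ n, ∃ l : List G, l.length = 2 * n ∧ (∀ x ∈ l, x ∈ S) ∧ l.sum = y := by
    intro y hy
    induction hy using Submodule.span_induction with
    | mem y hy =>
      obtain ⟨s, hs, rfl⟩ := hy
      exact ⟨1, [s₀, s], rfl, by simp [hs, hs₀], by simp⟩
    | zero => exact ⟨0, [], rfl, by simp, rfl⟩
    | add x y _ _ hx hy =>
      obtain ⟨n, l, hl, hm, rfl⟩ := hx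
      obtain ⟨n', l', hl', hm', rfl⟩ := hy
      refine ⟨n + n', l ++ l', by rw [List.length_append]; omega, fun x hx => ?_, by simp⟩
      exact (List.mem_append.1 hx).elim (hm x) (hm' x)
    | smul a x _ hx =>
      rcases z2 a with rfl | rfl
      · exact ⟨0, [], rfl, by simp, by simp⟩
      · simpa using hx
  have hnot : s₀ ∉ Submodule.span (ZMod 2) {y | ∃ s ∈ S, y = s₀ + s} := fun h => by
    obtain ⟨n, l, hl, hm, hsum⟩ := even s₀ h
    refine odd_list_sum_ne_zero hS hcard h5 n (s₀ :: l) (by simp [hl])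
      (by simpa [hs₀] using hm) ?_
    rw [List.sum_cons, hsum, ZModModule.add_self]
  obtain ⟨f, hf, hker⟩ := Submodule.exists_le_ker_of_notMem hnot
  refine ⟨f, fun s hs => ?_⟩
  have : f (s₀ + s) = 0 := hker (Submodule.subset_span ⟨s, hs, rfl⟩)
  rw [map_add] at this
  rw [← eq_of_add_eq_zero this]
  exact (z2 _).resolve_left hf

end Bipartite

/-! ### Maximal sum-free sets and their stabilizers -/

section Stabilizer

variable {G : Type*} [AddCommGroup G] [Module (ZMod 2) G]

/-- The stabilizer of a set under translation. -/
def stab (B : Finset G) : AddSubgroup G where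
  carrier := {c | ∀ b ∈ B, b + c ∈ B}
  zero_mem' := fun b hb => by simpa using hb
  add_mem' := fun {c d} hc hd b hb => by
    rw [← add_assoc]
    exact hd _ (hc _ hb)
  neg_mem' := fun {c} hc => by rwa [ZModModule.neg_eq_self]

/-- Adjoin `B + c` to `B`: every new violation of sum-freeness would write `c` as a sum of three
elements of `B`. -/
lemma mem_stab_of_maximal {B : Finset G} (hB : Maximal SumFree B) {c : G}
    (hc : ∀ a ∈ B, ∀ b ∈ B, ∀ d ∈ B, c ≠ a + b + d) : c ∈ stab B := by
  classical
  have e := ZModModule.add_self (G := G)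
  have hfree : SumFree (B ∪ B.image (· + c)) := by
    have key : ∀ {a b d : G}, a ∈ B → b ∈ B → d ∈ B → a + b ≠ d + c := fun {a b d} ha hb hd h =>
      hc a ha b hb d hd (by linear_combination (norm := abel) -h - e d)
    intro a ha b hb hab
    simp only [Finset.mem_union, Finset.mem_image] at ha hb hab
    rcases ha with ha | ⟨a, ha, rfl⟩ <;> rcases hb with hb | ⟨b, hb, rfl⟩ <;>
      rcases hab with hab | ⟨d, hd, hab⟩
    · exact hB.1 a ha b hb hab
    · exact key ha hb hd hab.symm
    · exact key ha hab hb (by linear_combination (norm := abel) e a)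
    · exact hB.1 a ha b hb (by rwa [show a + b = d by linear_combination (norm := abel) -hab])
    · exact key hb hab ha (by linear_combination (norm := abel) e b)
    · exact hB.1 a ha b hb (by rwa [show a + b = d by linear_combination (norm := abel) -hab])
    · exact hB.1 a ha b hb (by rwa [show a + b = a + c + (b + c) by
        linear_combination (norm := abel) -e c])
    · exact key ha hb hd (by linear_combination (norm := abel) -hab - e c)
  exact fun b hb => hB.2 hfree Finset.subset_union_left
    (Finset.mem_union_right _ (Finset.mem_image_of_mem _ hb))

lemma card_shifts_le_card_stab [Fintype G] [DecidableEq G] {B : Finset G} {ψ : V4 →ₗ[ZMod 2] G}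
    (hB : Maximal SumFree B)
    (h : ∀ c ∈ shifts B ψ, ∀ a ∈ B, ∀ b ∈ B, ∀ d ∈ B, c ≠ a + b + d) :
    (shifts B ψ).card ≤ Nat.card (stab B) := by
  rw [← Nat.card_eq_finsetCard]
  exact Nat.card_le_card_of_injective
    (fun c : shifts B ψ => (⟨c, mem_stab_of_maximal hB (h c c.2)⟩ : stab B))
    fun a b hab => Subtype.ext (congrArg (fun x : stab B => (x : G)) hab)

lemma exists_clebsch_map {B : Finset G} {a b c d e : G} (ha : a ∈ B) (hb : b ∈ B) (hc : c ∈ B)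
    (hd : d ∈ B) (he : e ∈ B) (h : a + b + c + d + e = 0) :
    ∃ ψ : V4 →ₗ[ZMod 2] G, ∀ x ∈ clebsch, ψ x ∈ B := by
  refine ⟨(LinearMap.toSpanSingleton (ZMod 2) G a).coprod
    ((LinearMap.toSpanSingleton (ZMod 2) G b).coprod
      ((LinearMap.toSpanSingleton (ZMod 2) G c).coprod
        (LinearMap.toSpanSingleton (ZMod 2) G d))), fun x hx => ?_⟩
  simp only [clebsch, Finset.mem_insert, Finset.mem_singleton] at hx
  rcases hx with rfl | rfl | rfl | rfl | rfl
  · simpa using ha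
  · simpa using hb
  · simpa using hc
  · simpa using hd
  · have := eq_of_add_eq_zero h
    simpa [← add_assoc, this] using he

end Stabilizer

/-! ### Caps as sum-free sets -/

variable {m : ℕ}

lemma SumFree.isCap {S : Finset (Fin m → ZMod 2)} (hS : SumFree S) : IsCap S := by
  intro T hT hT3
  rw [linearIndepOn_finset_iff]
  intro f hf i hi
  by_contra hne
  have z2 : ∀ a : ZMod 2, a ≠ 0 → a = 1 := by decide
  have hsum : ∑ x ∈ T.filter (fun x => f x ≠ 0), x = 0 := by
    rw [← hf, Finset.sum_filter]
    refine Finset.sum_congr rfl fun x _ => ?_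
    split_ifs with h
    · rw [z2 _ h, one_smul, id]
    · rw [not_not.1 h, zero_smul]
  have hpos : 0 < (T.filter (fun x => f x ≠ 0)).card :=
    Finset.card_pos.2 ⟨i, Finset.mem_filter.2 ⟨hi, hne⟩⟩
  have hle := (Finset.card_filter_le T (fun x => f x ≠ 0)).trans hT3
  have hsub : T.filter (fun x => f x ≠ 0) ⊆ S := (Finset.filter_subset _ _).trans hT
  generalize T.filter (fun x => f x ≠ 0) = R at hsum hpos hle hsub
  obtain h | h | h : R.card = 1 ∨ R.card = 2 ∨ R.card = 3 := by omega
  · obtain ⟨a, rfl⟩ := Finset.card_eq_one.1 h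
    rw [Finset.sum_singleton] at hsum
    exact hS.zero_notMem (hsum ▸ hsub (Finset.mem_singleton_self a))
  · obtain ⟨a, b, hab, rfl⟩ := Finset.card_eq_two.1 h
    rw [Finset.sum_pair hab] at hsum
    exact hab (eq_of_add_eq_zero hsum)
  · obtain ⟨a, b, c, hab, hac, hbc, rfl⟩ := Finset.card_eq_three.1 h
    rw [Finset.sum_insert (by simp [hab, hac]), Finset.sum_pair hbc, ← add_assoc] at hsum
    exact hS.add_add_ne_zero (hsub (by simp)) (hsub (by simp)) (hsub (by simp)) hsum

lemma IsCap.sumFree {S : Finset (Fin m → ZMod 2)} (hS : IsCap S) : SumFree S := by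
  have key : ∀ T ⊆ S, T.card ≤ 3 → ∑ x ∈ T, x = 0 → T = ∅ := fun T hT h3 h0 => by
    have := linearIndepOn_finset_iff.1 (hS T hT h3) (fun _ => 1) (by simpa using h0)
    exact Finset.eq_empty_of_forall_notMem fun x hx => one_ne_zero (this x hx)
  have hz : (0 : Fin m → ZMod 2) ∉ S := fun h =>
    Finset.singleton_ne_empty _ (key {0} (by simpa using h) (by simp) (by simp))
  intro a ha b hb hab
  rcases eq_or_ne a b with rfl | hne
  · exact hz (by rwa [ZModModule.add_self] at hab)
  refine Finset.insert_ne_empty a _ (key {a, b, a + b} ?_ Finset.card_le_three ?_)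
  · simp [Finset.insert_subset_iff, ha, hb, hab]
  · rw [Finset.sum_insert, Finset.sum_pair, ← add_assoc, ZModModule.add_self]
    · rintro h
      exact hz (by rwa [← left_eq_add.1 (h.trans (add_comm a b))])
    · simp only [Finset.mem_insert, Finset.mem_singleton, not_or]
      exact ⟨hne, fun h => hz (by rwa [← left_eq_add.1 h])⟩

lemma SumFree.two_mul_card_le {G : Type*} [AddCommGroup G] [Fintype G] {S : Finset G}
    (hS : SumFree S) : 2 * S.card ≤ Fintype.card G := by
  classical
  rcases S.eq_empty_or_nonempty with rfl | ⟨t, ht⟩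
  · simp
  have dis : Disjoint S (S.image (· + t)) := Finset.disjoint_left.2 fun x hx hx' => by
    obtain ⟨y, hy, rfl⟩ := Finset.mem_image.1 hx'
    exact hS y hy t ht hx
  have := Finset.card_le_univ (S ∪ S.image (· + t))
  rw [Finset.card_union_of_disjoint dis,
    Finset.card_image_of_injective _ (add_left_injective t)] at this
  omega

/-! ### Rank of the Gram matrix -/

lemma gramMatrix_apply (S : Finset (Fin m → ZMod 2)) (i j : Fin m) :
    gramMatrix S i j = ∑ s ∈ S, s i * s j := by
  simp [gramMatrix, Matrix.sum_apply, Matrix.vecMulVec_apply]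

lemma sum_eq_zero_of_mem_stab {G : Type*} [AddCommGroup G] [Module (ZMod 2) G] {B : Finset G}
    {c : G} (hc : c ∈ stab B) (hc0 : c ≠ 0) (f : G → ZMod 2) (hf : ∀ b ∈ B, f (b + c) = f b) :
    ∑ b ∈ B, f b = 0 :=
  Finset.sum_involution (fun b _ => b + c)
    (fun b hb => by rw [hf b hb, ZModModule.add_self])
    (fun b _ _ h => hc0 (by simpa using h))
    (fun b hb => hc b hb)
    (fun b _ => by rw [add_assoc, ZModModule.add_self, add_zero])

/-- More than four stabilizer elements include two that agree at `i` and `j`; translation by their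
difference pairs off equal terms of the entry. -/
lemma gramMatrix_eq_zero {B : Finset (Fin m → ZMod 2)} (hB : 8 ≤ Nat.card (stab B)) :
    gramMatrix B = 0 := by
  ext i j
  rw [gramMatrix_apply]
  have : Fintype (stab B) := Fintype.ofFinite _
  obtain ⟨x, y, hxy, h⟩ := Fintype.exists_ne_map_eq_of_card_lt
    (fun x : stab B => ((x : Fin m → ZMod 2) i, (x : Fin m → ZMod 2) j))
    (by rw [Nat.card_eq_fintype_card] at hB; simp; omega)
  rw [Prod.mk.injEq] at h
  refine sum_eq_zero_of_mem_stab (c := (x : Fin m → ZMod 2) - y) (sub_mem x.2 y.2) ?_ _ fun b _ => ?_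
  · exact sub_ne_zero.2 fun h => hxy (Subtype.ext h)
  · simp [h.1, h.2]

lemma rank_add_le {n : Type*} [Fintype n] (A B : Matrix n n (ZMod 2)) :
    (A + B).rank ≤ A.rank + B.rank := by
  unfold Matrix.rank
  rw [Matrix.mulVecLin_add]
  exact (Submodule.finrank_mono (LinearMap.range_add_le _ _)).trans
    (Submodule.finrank_add_le_finrank_add_finrank _ _)

/-- With `c k = 1`, the quantities `b i + b k * c i` are invariant under `b ↦ b + c`, so sums of
their products vanish by pairing; expanding leaves two matrices of rank at most one. -/
lemma rank_gramMatrix_le_two {B : Finset (Fin m → ZMod 2)} {c : Fin m → ZMod 2}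
    (hc : c ∈ stab B) (hc0 : c ≠ 0) : (gramMatrix B).rank ≤ 2 := by
  obtain ⟨k, hk⟩ := Function.ne_iff.1 hc0
  have hk1 : c k = 1 := (by decide : ∀ a : ZMod 2, a ≠ 0 → a = 1) _ hk
  have key : gramMatrix B = Matrix.vecMulVec (fun i => gramMatrix B i k) c +
      Matrix.vecMulVec c (fun j => gramMatrix B j k + gramMatrix B k k * c j) := by
    ext i j
    have h0 := sum_eq_zero_of_mem_stab hc hc0 (fun b => (b i + b k * c i) * (b j + b k * c j))
      fun b _ => by
        have : ∀ x y z : ZMod 2, x + y + (z + 1) * y = x + z * y := by decide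
        simp only [Pi.add_apply, hk1, this]
    have hexp : ∀ b : Fin m → ZMod 2, (b i + b k * c i) * (b j + b k * c j) =
        b i * b j + (b i * b k) * c j + c i * (b j * b k + (b k * b k) * c j) := fun b => by ring
    simp only [hexp, Finset.sum_add_distrib, ← Finset.sum_mul, ← Finset.mul_sum] at h0
    simp only [Matrix.add_apply, Matrix.vecMulVec_apply, gramMatrix_apply]
    rw [add_assoc] at h0
    exact eq_of_add_eq_zero h0
  rw [key]
  exact (rank_add_le _ _).trans
    (add_le_add (Matrix.rank_vecMulVec_le _ _) (Matrix.rank_vecMulVec_le _ _))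

lemma rank_gramMatrix_le_card (S : Finset (Fin m → ZMod 2)) : (gramMatrix S).rank ≤ S.card := by
  induction S using Finset.induction_on with
  | empty => simp [gramMatrix]
  | insert a S ha ih =>
    rw [gramMatrix, Finset.sum_insert ha, Finset.card_insert_of_notMem ha, add_comm S.card]
    exact (rank_add_le _ _).trans (add_le_add (Matrix.rank_vecMulVec_le _ _) ih)

/-- Each vector of `B \ S` changes the Gram matrix by a rank-one term at most. -/
lemma rank_gramMatrix_add_card_le {S B : Finset (Fin m → ZMod 2)} (h : S ⊆ B) :
    (gramMatrix S).rank + S.card ≤ (gramMatrix B).rank + B.card := by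
  have e : gramMatrix S = gramMatrix B + gramMatrix (B \ S) := by
    have := Finset.sum_sdiff (f := fun s => Matrix.vecMulVec s s) h
    rw [gramMatrix, gramMatrix, gramMatrix, ← this, add_comm (∑ x ∈ B \ S, _), add_assoc,
      ZModModule.add_self, add_zero]
  have h1 := rank_add_le (gramMatrix B) (gramMatrix (B \ S))
  have h2 := rank_gramMatrix_le_card (B \ S)
  have h3 := Finset.card_sdiff_add_card_eq_card h
  rw [← e] at h1
  omega

/-! ### Hyperplane complements -/

lemma mem_perp_span_singleton {v x : Fin m → ZMod 2} :
    x ∈ perp (Submodule.span (ZMod 2) {v}) ↔ x ⬝ᵥ v = 0 := by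
  refine ⟨fun h => h v (Submodule.mem_span_singleton_self v), fun h w hw => ?_⟩
  obtain ⟨a, rfl⟩ := Submodule.mem_span_singleton.1 hw
  rw [dotProduct_smul, h, smul_zero]

/-- The complement of the hyperplane `⟨v⟩^⊥`. -/
def hyperplaneCompl (v : Fin m → ZMod 2) : Finset (Fin m → ZMod 2) :=
  Finset.univ.filter fun x => x ⬝ᵥ v = 1

lemma mem_hyperplaneCompl {v x : Fin m → ZMod 2} : x ∈ hyperplaneCompl v ↔ x ⬝ᵥ v = 1 := by
  simp [hyperplaneCompl]

lemma eq_zero_or_eq_one : ∀ a : ZMod 2, a = 0 ∨ a = 1 := by decide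

lemma coe_hyperplaneCompl (v : Fin m → ZMod 2) : (hyperplaneCompl v : Set (Fin m → ZMod 2)) =
    Set.univ \ perp (Submodule.span (ZMod 2) {v}) := by
  ext x
  rw [Finset.mem_coe, mem_hyperplaneCompl, Set.mem_sdiff, mem_perp_span_singleton]
  rcases eq_zero_or_eq_one (x ⬝ᵥ v) with h | h <;> simp [h]

lemma sumFree_hyperplaneCompl (v : Fin m → ZMod 2) : SumFree (hyperplaneCompl v) := by
  intro a ha b hb hab
  rw [mem_hyperplaneCompl] at ha hb hab
  rw [add_dotProduct, ha, hb] at hab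
  exact absurd hab (by decide)

lemma isMaximalCap_hyperplaneCompl {v : Fin m → ZMod 2} (hv : (hyperplaneCompl v).Nonempty) :
    IsMaximalCap (hyperplaneCompl v) := by
  refine ⟨(sumFree_hyperplaneCompl v).isCap, fun T hT hlt => ?_⟩
  obtain ⟨t, ht⟩ := hv
  obtain ⟨hsub, y, hy, hyv⟩ := Finset.ssubset_iff_subset_ne.1 hlt |>.1,
    Finset.exists_of_ssubset hlt
  rw [mem_hyperplaneCompl] at hyv
  refine hT.sumFree y hy t (hsub ht) (hsub ?_)
  rw [mem_hyperplaneCompl] at ht ⊢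
  rw [add_dotProduct, (eq_zero_or_eq_one _).resolve_right hyv, ht, zero_add]

lemma card_hyperplaneCompl_le_card_stab (v : Fin m → ZMod 2) :
    (hyperplaneCompl v).card ≤ Nat.card (stab (hyperplaneCompl v)) := by
  rcases (hyperplaneCompl v).eq_empty_or_nonempty with h | ⟨t, ht⟩
  · simp [h]
  rw [← Nat.card_eq_finsetCard]
  refine Nat.card_le_card_of_injective (fun x : hyperplaneCompl v =>
    (⟨x + t, fun b hb => ?_⟩ : stab (hyperplaneCompl v))) fun a b hab => Subtype.ext ?_
  · have hx := x.2
    rw [mem_hyperplaneCompl] at *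
    rw [add_dotProduct, add_dotProduct, hb, hx, ht]
    decide
  · simpa using congrArg (fun x : stab (hyperplaneCompl v) => (x : Fin m → ZMod 2)) hab

/-! ### Excluding five-term zero sums, and conclusion -/

/-- A large cap whose Gram matrix has large rank contains no five vectors with sum zero. -/
lemma five_sum_ne_zero (hm : 7 ≤ m) {S : Finset (Fin m → ZMod 2)} (hS : SumFree S)
    (hcard : 2 ^ (m - 2) + 2 ^ (m - 4) + 1 ≤ S.card + (gramMatrix S).rank) :
    ∀ a ∈ S, ∀ b ∈ S, ∀ c ∈ S, ∀ d ∈ S, ∀ e ∈ S, a + b + c + d + e ≠ 0 := by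
  intro a ha b hb c hc d hd e he h
  obtain ⟨B, hSB, hB⟩ := Finite.exists_le_maximal hS
  obtain ⟨ψ, hψ⟩ := exists_clebsch_map (hSB ha) (hSB hb) (hSB hc) (hSB hd) (hSB he) h
  have hr : (gramMatrix S).rank ≤ m := by simpa using (gramMatrix S).rank_le_width
  have hSB' := Finset.card_le_card hSB
  have hG : Fintype.card (Fin m → ZMod 2) = 2 ^ m := by simp
  obtain ⟨n, rfl⟩ : ∃ n, m = n + 7 := ⟨m - 7, by omega⟩
  have hn : n + 1 ≤ 2 ^ n := Nat.lt_two_pow_self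
  have hn1 : 1 ≤ n → 2 ≤ 2 ^ n := fun h1 => by
    calc 2 = 2 ^ 1 := rfl
      _ ≤ 2 ^ n := Nat.pow_le_pow_right (by norm_num) h1
  have e0 : 2 ^ (n + 7) = 128 * 2 ^ n := by ring
  have e2 : 2 ^ (n + 7 - 2) = 32 * 2 ^ n := by rw [show n + 7 - 2 = n + 5 by omega]; ring
  have e4 : 2 ^ (n + 7 - 4) = 8 * 2 ^ n := by rw [show n + 7 - 4 = n + 3 by omega]; ring
  rw [e2, e4] at hcard
  rw [e0] at hG
  have hshift : ∀ c ∈ shifts B ψ, ∀ a ∈ B, ∀ b ∈ B, ∀ d ∈ B, c ≠ a + b + d := by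
    rintro c hc a ha b hb d hd rfl
    -- For m = 7 the bound 36 plus rank 7 would not contradict the required 41; 33 + 7 does.
    rcases Nat.eq_zero_or_pos n with rfl | hpos
    · have := card_le_thirty_three_of_triple hB.1 hψ ha hb hd hc rfl hG
      omega
    · have := card_le_of_triple hB.1 hψ ha hb hd hc
      have := hn1 hpos
      omega
  have hF := card_shifts_le_card_stab hB hshift
  have h4 := sixteen_card_le_shifts hB.1 hψ
  have h5 := sixteen_card_le hB.1 hψ
  have hrank := rank_gramMatrix_add_card_le hSB
  rw [hG] at h4 h5
  rcases le_or_gt 8 (Nat.card (stab B)) with h8 | h8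
  · rw [gramMatrix_eq_zero h8, Matrix.rank_zero] at hrank
    omega
  · rcases Nat.eq_zero_or_pos n with rfl | hpos
    · have hdvd : Nat.card (stab B) ∣ 128 := by
        have := AddSubgroup.card_addSubgroup_dvd_card (stab B)
        rwa [Nat.card_eq_fintype_card (α := Fin (0 + 7) → ZMod 2), hG] at this
      have h4' : Nat.card (stab B) ≤ 4 := by
        interval_cases Nat.card (stab B) <;> omega
      have : Nontrivial (stab B) := Finite.one_lt_card_iff_nontrivial.1 (by omega)
      obtain ⟨c, hc⟩ := exists_ne (0 : stab B)
      have := rank_gramMatrix_le_two c.2 (by simpa using hc)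
      omega
    · have := hn1 hpos
      omega

end BinaryCap

theorem mainTheorem1 (m : ℕ) (hm : 7 ≤ m) (S : Finset (Fin m → ZMod 2))
    (hS : BinaryCap.IsCap S)
    (hcard : (S.card : ℤ) ≥
      2 ^ (m - 2) + 2 ^ (m - 4) - ((BinaryCap.gramMatrix S).rank : ℤ) + 1) :
    (∃ (v : Fin m → ZMod 2) (T : Finset (Fin m → ZMod 2)),
      (T : Set (Fin m → ZMod 2)) = Set.univ \ BinaryCap.perp (Submodule.span (ZMod 2) {v}) ∧
      BinaryCap.IsMaximalCap T ∧ S ⊆ T) ∧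
    (S.card : ℤ) ≤ 2 ^ (m - 1) - ((BinaryCap.gramMatrix S).rank : ℤ) := by
  have hcard' : 2 ^ (m - 2) + 2 ^ (m - 4) + 1 ≤ S.card + (BinaryCap.gramMatrix S).rank := by
    zify
    linarith
  have hr : (BinaryCap.gramMatrix S).rank ≤ m := by
    simpa using (BinaryCap.gramMatrix S).rank_le_width
  have hG : Fintype.card (Fin m → ZMod 2) = 2 ^ m := by simp
  -- Since the rank is at most `m`, this gives |S| > 2^(m-2), the density needed for the functional.
  have h4 : m < 2 ^ (m - 4) + 1 := by
    obtain ⟨n, rfl⟩ : ∃ n, m = n + 7 := ⟨m - 7, by omega⟩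
    have : n + 1 ≤ 2 ^ n := Nat.lt_two_pow_self
    rw [show n + 7 - 4 = n + 3 by omega, pow_add]
    omega
  have e2 : 4 * 2 ^ (m - 2) = 2 ^ m := by
    rw [mul_comm, show 4 = 2 ^ 2 by norm_num, ← pow_add, Nat.sub_add_cancel (by omega)]
  have e1 : 2 * 2 ^ (m - 1) = 2 ^ m := by
    rw [← pow_succ', Nat.sub_add_cancel (by omega)]
  obtain ⟨f, hf⟩ := BinaryCap.exists_dual_eq_one hS.sumFree (by omega)
    (BinaryCap.five_sum_ne_zero hm hS.sumFree hcard')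
  obtain ⟨v, rfl⟩ := (dotProductEquiv (ZMod 2) (Fin m)).surjective f
  have hST : S ⊆ BinaryCap.hyperplaneCompl v := fun s hs => by
    rw [BinaryCap.mem_hyperplaneCompl, dotProduct_comm]
    exact hf s hs
  have hle := Finset.card_le_card hST
  have h8 : 2 ^ 3 ≤ 2 ^ (m - 2) := Nat.pow_le_pow_right (by norm_num) (by omega)
  refine ⟨⟨v, _, BinaryCap.coe_hyperplaneCompl v,
    BinaryCap.isMaximalCap_hyperplaneCompl (Finset.card_pos.1 (by omega)), hST⟩, ?_⟩
  have hrank := BinaryCap.rank_gramMatrix_add_card_le hST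
  rw [BinaryCap.gramMatrix_eq_zero
    (le_trans (by omega) (BinaryCap.card_hyperplaneCompl_le_card_stab v)),
    Matrix.rank_zero] at hrank
  have htwo := (BinaryCap.sumFree_hyperplaneCompl v).two_mul_card_le
  have : (BinaryCap.gramMatrix S).rank + S.card ≤ 2 ^ (m - 1) := by omega
  zify at this
  linarith
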